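/- For an integer $q\ge 2$ let $T_{q+1}$ be the regular tree in which every vertex has $q+1$ neighbours, and let $\mathrm{Isom}(T_{q+1})$ be its automorphism group with the topology of pointwise convergence on vertices. An end of $T_{q+1}$ is a class of rays, two rays being equivalent if they have a common tail. For an end $\omega$, let $\mathrm{Isom}(T_{q+1})_\omega$ be the stabiliser of $\omega$. A *scale group* is a closed subgroup of $\mathrm{Isom}(T_{q+1})_\omega$, for some $q\ge 2$ and some end $\omega$, that is transitive on the vertices of $T_{q+1}$. A topological group has a *faithful representation as a scale group* if it is isomorphic, as a topological group, to a scale group. The *scale* of an element $y$ of a topological group $G$ that has a compact open subgroup is $s(y)=\min_U\,[yUy^{-1}:yUy^{-1}\cap U]$, where $U$ ranges over the compact open subgroups of $G$. Let $G$ be a locally compact group. Then $G$ has a faithful representation as a scale group if and only if 1. $G$ has no non-trivial compact normal subgroup; and 2. there is an open normal subgroup $H\trianglelefteq G$ with $G/H\cong\mathbb Z$ such that 3. there are a compact open subgroup $V\le G$ and an element $x\in G$ with $xVx^{-1}\subsetneq V$ and $\bigcup_{n\in\mathbb Z}x^nVx^{-n}=H$. Moreover, if $G$ has a faithful representation as a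 scale group, then $q=\min\{s(y) : y\in G,\ s(y)\ne 1\}$ exists, $q\ge 2$, and $G$ is isomorphic, as a topological group, to a scale group on $T_{q+1}$, that is, to a closed vertex-transitive subgroup of $\mathrm{Isom}(T_{q+1})_\omega$, where $\omega$ is an end of $T_{q+1}$. -/

import Mathlib

universe u

namespace ScaleGroup

section Tree

variable {V : Type u} {T : SimpleGraph V}

/-- `T` is a regular tree in which every vertex has exactly `d` neighbours. -/
structure IsRegularTree (T : SimpleGraph V) (d : ℕ) : Prop where
  isTree : T.IsTree
  valency : ∀ v : V, (T.neighborSet v).encard = d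

/-- The isometry group of the tree `T` is its automorphism group `T ≃g T`, with the topology of
pointwise convergence on the (discrete) set of vertices: the stabilisers of finite sets of
vertices form a base of neighbourhoods of the identity. -/
instance isomTopology (T : SimpleGraph V) : TopologicalSpace (T ≃g T) :=
  TopologicalSpace.induced (fun g : T ≃g T => (g : V → V))
    (@Pi.topologicalSpace V (fun _ => V) (fun _ => ⊥))

/-- A ray: an infinite path without repetitions, starting at some vertex. -/
structure Ray (T : SimpleGraph V) where
  toFun : ℕ → V
  adj : ∀ n, T.Adj (toFun n) (toFun (n + 1))
  inj : Function.Injective toFun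

/-- Two rays of a tree are equivalent if they have a common tail. -/
instance raySetoid (T : SimpleGraph V) : Setoid (Ray T) where
  r r s := ∃ m n, ∀ k, r.toFun (m + k) = s.toFun (n + k)
  iseqv :=
    { refl := fun _ => ⟨0, 0, fun _ => rfl⟩
      symm := fun ⟨m, n, h⟩ => ⟨n, m, fun k => (h k).symm⟩
      trans := by
        rintro r s t ⟨m, n, h⟩ ⟨n', p, h'⟩
        refine ⟨m + n', p + n, fun k => ?_⟩
        have h1 := h (n' + k)
        have h2 := h' (n + k)
        rw [← add_assoc] at h1 h2
        rw [h1, add_assoc p n k, ← h2]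
        congr 1
        omega }

/-- An end of the tree `T`, i.e. a point of its boundary: a class of rays with common tails. -/
def TreeEnd (T : SimpleGraph V) : Type u := Quotient (raySetoid T)

/-- The image of a ray under an automorphism. -/
def Ray.map (g : T ≃g T) (r : Ray T) : Ray T where
  toFun n := g (r.toFun n)
  adj n := g.map_rel_iff.mpr (r.adj n)
  inj := g.injective.comp r.inj

/-- The action of an automorphism on the ends. -/
def TreeEnd.map (g : T ≃g T) : TreeEnd T → TreeEnd T :=
  Quotient.map (Ray.map g) (fun _ _ ⟨m, n, h⟩ => ⟨m, n, fun k => congrArg g (h k)⟩)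

/-- `P` is a scale group on the tree `T` with respect to the end `ω`: a closed subgroup of the
isometry group which fixes `ω` and is transitive on the vertices. -/
structure IsScaleGroup (T : SimpleGraph V) (ω : TreeEnd T) (P : Subgroup (T ≃g T)) : Prop where
  isClosed : IsClosed (P : Set (T ≃g T))
  fixes : ∀ g ∈ P, TreeEnd.map g ω = ω
  transitive : ∀ v w : V, ∃ g ∈ P, g v = w

end Tree

/-- The topological group `G` has a faithful representation as a scale group on the regular tree
of valency `q + 1`: it is isomorphic, as a topological group, to a scale group on that tree. -/
def HasFaithfulScaleRep (G : Type u) [Group G] [TopologicalSpace G] (q : ℕ) : Prop :=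
  ∃ (V : Type u) (T : SimpleGraph V) (ω : TreeEnd T) (P : Subgroup (T ≃g T)),
    IsRegularTree T (q + 1) ∧ IsScaleGroup T ω P ∧ Nonempty (G ≃ₜ* P)

/-- The conjugate `x U x⁻¹` of a subgroup. -/
def conj {G : Type u} [Group G] (x : G) (U : Subgroup G) : Subgroup G :=
  U.map (MulAut.conj x).toMonoidHom

/-- The scale `s(x)` of an element: the least index `[x U x⁻¹ : x U x⁻¹ ∩ U]`, for `U` ranging over
the compact open subgroups. (`U.relIndex K` is the index of `K ∩ U` in `K`.) -/
noncomputable def scale {G : Type u} [Group G] [TopologicalSpace G] (x : G) : ℕ :=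
  sInf {n : ℕ | ∃ U : Subgroup G, IsOpen (U : Set G) ∧ IsCompact (U : Set G) ∧
    n = U.relIndex (conj x U)}

end ScaleGroup

/-! Both sides of the equivalence amount to the existence of a pair `(U, t)` as in `IsContraction`:
a compact open `U` with trivial normal core, and `t` with `tUt⁻¹ ≤ U` of index `q ≥ 2`, such that
every element lies in some `t⁻ⁿUtᵐ`.

In a scale group, the end gives each vertex a parent, its neighbour on the ray towards the end. The
group commutes with this parent map, so the stabiliser `U` of a vertex, with `t` moving that vertex
to one of its children, is such a pair, and `q` counts the children
(`HasFaithfulScaleRep.exists_isContraction`). Conversely, `gU ↦ gt⁻¹U` is a parent map on `G ⧸ U`.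
It makes the cosets into a regular tree with an invariant end, on which `G` acts as a closed
vertex-transitive group (`IsContraction.hasFaithfulScaleRep`).

A pair yields the algebraic conditions with `H` the union of the `t⁻ⁿUtⁿ`
(`eq_bot_and_exists_of_isContraction`). In the other direction `x` need not generate modulo `H`: a
generator `t` has a power congruent to `x`, and a finite intersection of conjugates of `V` is
contracted by `t` itself (`exists_isContraction`).

For the scale, the ratio `[yWy⁻¹ : yWy⁻¹ ∩ W] / [W : yWy⁻¹ ∩ W]` does not depend on `W`, so any `W ≤
yWy⁻¹` attains the minimum. Every `y` carries one member of the chain `t⁻ⁿUtⁿ` to another, so its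
scale is `1` or at least `q`, and `t⁻¹` attains `q` (`IsContraction.isLeast_scale`). -/

namespace ScaleGroup

/-! ### Indices of conjugates and the scale of a contracted group -/

section Contraction

variable {G : Type u} [Group G]

theorem mem_conj {x y : G} {U : Subgroup G} : y ∈ conj x U ↔ x⁻¹ * y * x ∈ U := by
  constructor
  · rintro ⟨u, hu, rfl⟩
    have : x⁻¹ * (x * u * x⁻¹) * x = u := by group
    simpa [this] using hu
  · intro h
    exact ⟨_, h, by simp [mul_assoc]⟩

theorem conj_mul (x y : G) (U : Subgroup G) : conj (x * y) U = conj x (conj y U) := by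
  ext z
  simp only [mem_conj, mul_inv_rev, mul_assoc]

theorem conj_one (U : Subgroup G) : conj 1 U = U := by
  ext z
  simp [mem_conj]

theorem conj_mono {U W : Subgroup G} (x : G) (h : U ≤ W) : conj x U ≤ conj x W :=
  Subgroup.map_mono h

theorem conj_eq_self {x : G} {U : Subgroup G} (h : x ∈ U) : conj x U = U := by
  ext z
  rw [mem_conj, Subgroup.mul_mem_cancel_right _ h, Subgroup.mul_mem_cancel_left _ (inv_mem h)]

theorem conj_relIndex_conj (x : G) (U W : Subgroup G) :
    (conj x U).relIndex (conj x W) = U.relIndex W :=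
  Subgroup.relIndex_map_map_of_injective U W (MulAut.conj x).injective

theorem conj_pow_le {t : G} {U : Subgroup G} (h : conj t U ≤ U) (n : ℕ) : conj (t ^ n) U ≤ U := by
  induction n with
  | zero => simp [conj_one]
  | succ n ih => rw [pow_succ, conj_mul]; exact (conj_mono _ h).trans ih

/-- The increasing family of conjugates `t⁻ⁿ U tⁿ` of a subgroup contracted by `t`. -/
theorem conj_pow_inv_mono {t : G} {U : Subgroup G} (h : conj t U ≤ U) :
    Monotone fun n : ℕ => conj (t ^ n)⁻¹ U := by
  intro m n hmn
  obtain ⟨k, rfl⟩ := Nat.exists_eq_add_of_le hmn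
  have := conj_mono (t ^ (m + k))⁻¹ (conj_pow_le h k)
  rw [← conj_mul] at this
  have e : (t ^ (m + k))⁻¹ * t ^ k = (t ^ m)⁻¹ := by rw [add_comm, pow_add]; group
  rwa [e] at this

theorem relIndex_conj_pow_succ_inv (t : G) (U : Subgroup G) (n : ℕ) :
    (conj (t ^ n)⁻¹ U).relIndex (conj (t ^ (n + 1))⁻¹ U) = (conj t U).relIndex U := by
  rw [← conj_relIndex_conj (t ^ (n + 1))⁻¹ (conj t U), ← conj_mul]
  congr 2
  rw [pow_succ']
  group

theorem relIndex_mul_relIndex_inf {A B C : Subgroup G} :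
    A.relIndex B * C.relIndex (A ⊓ B) = (A ⊓ B ⊓ C).relIndex B := by
  rw [mul_comm, Subgroup.relIndex_inf_mul_relIndex, inf_right_comm, Subgroup.inf_relIndex_right,
    inf_comm]

/-- Put `D = A ⊓ B ⊓ C`. Multiplied by the indices of `D` in the pairwise intersections, both sides
become `[A : D][B : D][C : D]`; finiteness allows cancelling. -/
theorem relIndex_cocycle {A B C : Subgroup G} (h : (A ⊓ B ⊓ C).relIndex A ≠ 0)
    (h' : (A ⊓ B ⊓ C).relIndex B ≠ 0) (h'' : (A ⊓ B ⊓ C).relIndex C ≠ 0) :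
    A.relIndex B * B.relIndex C * C.relIndex A = B.relIndex A * C.relIndex B * A.relIndex C := by
  have e1 := relIndex_mul_relIndex_inf (A := A) (B := B) (C := C)
  have e2 := relIndex_mul_relIndex_inf (A := B) (B := C) (C := A)
  have e3 := relIndex_mul_relIndex_inf (A := C) (B := A) (C := B)
  have f1 := relIndex_mul_relIndex_inf (A := B) (B := A) (C := C)
  have f2 := relIndex_mul_relIndex_inf (A := C) (B := B) (C := A)
  have f3 := relIndex_mul_relIndex_inf (A := A) (B := C) (C := B)
  rw [inf_comm B A] at f1
  rw [inf_comm C B] at f2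
  rw [inf_comm A C] at f3
  have g2 : B ⊓ C ⊓ A = A ⊓ B ⊓ C := by ac_rfl
  have g3 : C ⊓ A ⊓ B = A ⊓ B ⊓ C := by ac_rfl
  rw [g2] at e2 f2
  rw [g3] at e3 f3
  rw [← e1] at h'
  rw [← e2] at h''
  rw [← e3] at h
  have hne : C.relIndex (A ⊓ B) * A.relIndex (B ⊓ C) * B.relIndex (C ⊓ A) ≠ 0 :=
    mul_ne_zero (mul_ne_zero (right_ne_zero_of_mul h') (right_ne_zero_of_mul h''))
      (right_ne_zero_of_mul h)
  apply mul_right_cancel₀ hne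
  calc _ = (A.relIndex B * C.relIndex (A ⊓ B)) * (B.relIndex C * A.relIndex (B ⊓ C)) *
        (C.relIndex A * B.relIndex (C ⊓ A)) := by ring
    _ = (B.relIndex A * C.relIndex (A ⊓ B)) * (C.relIndex B * A.relIndex (B ⊓ C)) *
        (A.relIndex C * B.relIndex (C ⊓ A)) := by rw [e1, e2, e3, f1, f2, f3]; ring
    _ = _ := by ring

variable [TopologicalSpace G]

/-- The element `t` contracts the compact open subgroup `U` with index at least two, the group is
exhausted by the translates `t⁻ⁿ U tᵐ`, and the normal core of `U` is trivial. -/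
structure IsContraction (U : Subgroup G) (t : G) : Prop where
  isOpen : IsOpen (U : Set G)
  isCompact : IsCompact (U : Set G)
  conj_le : conj t U ≤ U
  two_le : 2 ≤ (conj t U).relIndex U
  exhausts : ∀ g : G, ∃ m n : ℕ, t ^ n * g * (t ^ m)⁻¹ ∈ U
  core : ∀ u : G, (∀ g : G, g * u * g⁻¹ ∈ U) → u = 1

theorem scale_le {U : Subgroup G} (y : G) (hU : IsOpen (U : Set G)) (hU' : IsCompact (U : Set G)) :
    scale y ≤ U.relIndex (conj y U) :=
  Nat.sInf_le ⟨U, hU, hU', rfl⟩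

theorem le_scale {U : Subgroup G} (y : G) (hU : IsOpen (U : Set G)) (hU' : IsCompact (U : Set G))
    {k : ℕ} (h : ∀ W : Subgroup G, IsOpen (W : Set G) → IsCompact (W : Set G) →
      k ≤ W.relIndex (conj y W)) : k ≤ scale y := by
  refine le_csInf ⟨_, U, hU, hU', rfl⟩ ?_
  rintro _ ⟨W, hW, hW', rfl⟩
  exact h W hW hW'

variable [IsTopologicalGroup G]

theorem isOpen_conj {U : Subgroup G} (x : G) (h : IsOpen (U : Set G)) :
    IsOpen (conj x U : Set G) := by
  have : (conj x U : Set G) = (fun y => x⁻¹ * y * x) ⁻¹' U := by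
    ext y; exact mem_conj
  rw [this]
  exact h.preimage (by fun_prop)

theorem isCompact_conj {U : Subgroup G} (x : G) (h : IsCompact (U : Set G)) :
    IsCompact (conj x U : Set G) := by
  have : (conj x U : Set G) = (fun y => x * y * x⁻¹) '' U := by
    ext y; simp [conj]
  rw [this]
  exact h.image (by fun_prop)

theorem relIndex_ne_zero_of_isOpen_of_isCompact {U W : Subgroup G} (hU : IsOpen (U : Set G))
    (hW : IsCompact (W : Set G)) : U.relIndex W ≠ 0 := by
  have : CompactSpace W := isCompact_iff_compactSpace.mp hW
  have ho : IsOpen (U.subgroupOf W : Set W) := hU.preimage continuous_subtype_val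
  have := Subgroup.quotient_finite_of_isOpen _ ho
  exact Subgroup.index_ne_zero_of_finite

theorem relIndex_cocycle_of_isOpen {A B C : Subgroup G} (hA : IsOpen (A : Set G))
    (hB : IsOpen (B : Set G)) (hC : IsOpen (C : Set G)) (hA' : IsCompact (A : Set G))
    (hB' : IsCompact (B : Set G)) (hC' : IsCompact (C : Set G)) :
    A.relIndex B * B.relIndex C * C.relIndex A = B.relIndex A * C.relIndex B * A.relIndex C := by
  have ho : IsOpen ((A ⊓ B ⊓ C : Subgroup G) : Set G) := (hA.inter hB).inter hC
  exact relIndex_cocycle (relIndex_ne_zero_of_isOpen_of_isCompact ho hA')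
    (relIndex_ne_zero_of_isOpen_of_isCompact ho hB')
    (relIndex_ne_zero_of_isOpen_of_isCompact ho hC')

/-- The modular ratio `[yUy⁻¹ : yUy⁻¹ ∩ U] / [U : yUy⁻¹ ∩ U]` is the same for all compact open
subgroups `U`. -/
theorem relIndex_conj_mul_eq {U W : Subgroup G} (y : G) (hU : IsOpen (U : Set G))
    (hU' : IsCompact (U : Set G)) (hW : IsOpen (W : Set G)) (hW' : IsCompact (W : Set G)) :
    W.relIndex (conj y W) * (conj y U).relIndex U =
      (conj y W).relIndex W * U.relIndex (conj y U) := by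
  have hyU := isOpen_conj y hU
  have hyU' := isCompact_conj y hU'
  have hyW := isOpen_conj y hW
  have hyW' := isCompact_conj y hW'
  have e1 := relIndex_cocycle_of_isOpen hW hyW hyU hW' hyW' hyU'
  have e2 := relIndex_cocycle_of_isOpen hW hyU hU hW' hyU' hU'
  rw [conj_relIndex_conj, conj_relIndex_conj] at e1
  have n1 := relIndex_ne_zero_of_isOpen_of_isCompact hW hyU'
  have n2 := relIndex_ne_zero_of_isOpen_of_isCompact hyU hW'
  have n3 := relIndex_ne_zero_of_isOpen_of_isCompact hW hU'
  have n4 := relIndex_ne_zero_of_isOpen_of_isCompact hU hW'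
  apply mul_right_cancel₀ (mul_ne_zero (mul_ne_zero n1 n2) (mul_ne_zero n3 n4))
  calc _ = (W.relIndex (conj y W) * W.relIndex U * (conj y U).relIndex W) *
        (W.relIndex (conj y U) * (conj y U).relIndex U * U.relIndex W) := by ring
    _ = _ := by rw [e1, e2]; ring

/-- The modular ratio of `U` is here an integer, and for any other `W` the first index is that
integer times a positive one. -/
theorem scale_eq_of_le_conj {U : Subgroup G} {y : G} (hU : IsOpen (U : Set G))
    (hU' : IsCompact (U : Set G)) (h : U ≤ conj y U) : scale y = U.relIndex (conj y U) := by
  apply le_antisymm (scale_le y hU hU') (le_scale y hU hU' fun W hW hW' => ?_)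
  have e := relIndex_conj_mul_eq y hU hU' hW hW'
  rw [Subgroup.relIndex_eq_one.mpr h, mul_one] at e
  rw [e]
  exact Nat.le_mul_of_pos_left _ (Nat.pos_of_ne_zero
    (relIndex_ne_zero_of_isOpen_of_isCompact (isOpen_conj y hW) hW'))

theorem scale_eq_one_of_conj_le {U : Subgroup G} {y : G} (hU : IsOpen (U : Set G))
    (hU' : IsCompact (U : Set G)) (h : conj y U ≤ U) : scale y = 1 := by
  apply le_antisymm
  · rw [← Subgroup.relIndex_eq_one.mpr h]
    exact scale_le y hU hU'
  · exact le_scale y hU hU' fun W hW hW' => Nat.pos_of_ne_zero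
      (relIndex_ne_zero_of_isOpen_of_isCompact hW (isCompact_conj y hW'))

namespace IsContraction

variable {U : Subgroup G} {t : G}

/-- Since `y = t⁻ⁿutᵐ` with `u ∈ U`, conjugation by `y` takes `t⁻ᵐUtᵐ` to `t⁻ⁿUtⁿ`. It shrinks if `n
≤ m`; otherwise the first step of the chain already contributes the factor `[U : tUt⁻¹]`. -/
theorem scale_eq_one_or_le (h : IsContraction U t) (y : G) :
    scale y = 1 ∨ (conj t U).relIndex U ≤ scale y := by
  obtain ⟨m, n, hu⟩ := h.exhausts y
  have hmono := conj_pow_inv_mono h.conj_le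
  have hU := isOpen_conj (t ^ m)⁻¹ h.isOpen
  have hU' := isCompact_conj (t ^ m)⁻¹ h.isCompact
  have hy : conj y (conj (t ^ m)⁻¹ U) = conj (t ^ n)⁻¹ U := by
    have e : (t ^ n)⁻¹ * (t ^ n * y * (t ^ m)⁻¹) = y * (t ^ m)⁻¹ := by group
    rw [← conj_mul, ← e, conj_mul, conj_eq_self hu]
  rcases le_or_gt n m with hnm | hnm
  · left
    exact scale_eq_one_of_conj_le hU hU' (by rw [hy]; exact hmono hnm)
  · right
    rw [scale_eq_of_le_conj hU hU' (by rw [hy]; exact hmono hnm.le), hy,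
      ← Subgroup.relIndex_mul_relIndex _ _ _ (hmono m.le_succ) (hmono hnm),
      Nat.succ_eq_add_one, relIndex_conj_pow_succ_inv]
    exact Nat.le_mul_of_pos_right _ (Nat.pos_of_ne_zero
      (relIndex_ne_zero_of_isOpen_of_isCompact (isOpen_conj _ h.isOpen)
        (isCompact_conj _ h.isCompact)))

theorem scale_inv (h : IsContraction U t) : scale t⁻¹ = (conj t U).relIndex U := by
  have h1 : conj t⁻¹ (conj t U) = U := by rw [← conj_mul, inv_mul_cancel, conj_one]
  have h2 : U ≤ conj t⁻¹ U := by
    have := conj_mono t⁻¹ h.conj_le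
    rwa [h1] at this
  rw [scale_eq_of_le_conj h.isOpen h.isCompact h2, ← conj_relIndex_conj t⁻¹ (conj t U), h1]

theorem isLeast_scale (h : IsContraction U t) :
    IsLeast {n : ℕ | (∃ y : G, scale y = n) ∧ n ≠ 1} ((conj t U).relIndex U) := by
  refine ⟨⟨⟨t⁻¹, h.scale_inv⟩, by have := h.two_le; omega⟩, ?_⟩
  rintro _ ⟨⟨y, rfl⟩, hy⟩
  exact (h.scale_eq_one_or_le y).resolve_left hy

end IsContraction

end Contraction

end ScaleGroup

namespace ScaleGroup

/-! ### From a contraction to the algebraic conditions -/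

section Conditions

variable {G : Type u} [Group G]

theorem conj_zpow_le_conj_pow_inv {x : G} {V : Subgroup G} (h : conj x V ≤ V) (n : ℤ) :
    conj (x ^ n) V ≤ conj (x ^ n.natAbs)⁻¹ V := by
  rcases Int.natAbs_eq n with hn | hn
  · have h0 := conj_pow_inv_mono h (Nat.zero_le n.natAbs)
    simp only [pow_zero, inv_one, conj_one] at h0
    refine le_trans ?_ h0
    rw [hn, zpow_natCast]
    exact conj_pow_le h _
  · conv_lhs => rw [hn]
    rw [zpow_neg, zpow_natCast]

theorem mem_iUnion_conj_zpow {x g : G} {V : Subgroup G} (h : conj x V ≤ V) :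
    (g ∈ ⋃ n : ℤ, (conj (x ^ n) V : Set G)) ↔ ∃ n : ℕ, g ∈ conj (x ^ n)⁻¹ V := by
  rw [Set.mem_iUnion]
  constructor
  · rintro ⟨n, hn⟩
    exact ⟨_, conj_zpow_le_conj_pow_inv h n hn⟩
  · rintro ⟨n, hn⟩
    refine ⟨-n, ?_⟩
    rw [zpow_neg, zpow_natCast]
    exact hn

variable [TopologicalSpace G]

namespace IsContraction

variable {U : Subgroup G} {t : G}

/-- Otherwise `U = tⁿUt⁻ⁿ ≤ tUt⁻¹`, against the index being at least two. -/
theorem pow_notMem (h : IsContraction U t) {n : ℕ} (hn : n ≠ 0) : t ^ n ∉ U := by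
  intro hmem
  obtain ⟨k, rfl⟩ := Nat.exists_eq_succ_of_ne_zero hn
  have h1 : conj (t ^ (k + 1)) U = U := conj_eq_self hmem
  have h2 : U ≤ conj t U := by
    calc U = conj t (conj (t ^ k) U) := by rw [← conj_mul, ← pow_succ', h1]
      _ ≤ conj t U := conj_mono t (conj_pow_le h.conj_le k)
  have := h.two_le
  rw [Subgroup.relIndex_eq_one.mpr h2] at this
  omega

theorem conj_lt (h : IsContraction U t) : conj t U < U := by
  refine lt_of_le_not_ge h.conj_le fun hle => ?_
  have := h.two_le
  rw [Subgroup.relIndex_eq_one.mpr hle] at this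
  omega

/-- The increasing union of the conjugates `t⁻ⁿ U tⁿ`. -/
def union (_ : IsContraction U t) : Subgroup G := ⨆ n : ℕ, conj (t ^ n)⁻¹ U

theorem mem_union (h : IsContraction U t) {g : G} : g ∈ h.union ↔ ∃ n : ℕ, g ∈ conj (t ^ n)⁻¹ U :=
  Subgroup.mem_iSup_of_directed (conj_pow_inv_mono h.conj_le).directed_le

theorem conj_mem_union (h : IsContraction U t) {g : G} (hg : g ∈ h.union) :
    t * g * t⁻¹ ∈ h.union ∧ t⁻¹ * g * t ∈ h.union := by
  obtain ⟨n, hn⟩ := h.mem_union.mp hg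
  have hn1 := conj_pow_inv_mono h.conj_le n.le_succ hn
  rw [mem_conj] at hn
  simp only [mem_conj] at hn1
  refine ⟨h.mem_union.mpr ⟨n, mem_conj.mpr ?_⟩, h.mem_union.mpr ⟨n + 1, mem_conj.mpr ?_⟩⟩
  · apply h.conj_le
    rw [mem_conj]
    have e : t⁻¹ * ((t ^ n)⁻¹⁻¹ * (t * g * t⁻¹) * (t ^ n)⁻¹) * t
        = (t ^ n)⁻¹⁻¹ * g * (t ^ n)⁻¹ := by group
    rwa [e]
  · have e : (t ^ (n + 1))⁻¹⁻¹ * (t⁻¹ * g * t) * (t ^ (n + 1))⁻¹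
        = (t ^ n)⁻¹⁻¹ * g * (t ^ n)⁻¹ := by group
    rwa [e]

theorem normal_union (h : IsContraction U t) : h.union.Normal := by
  have hpow : ∀ n : ℕ, ∀ g ∈ h.union, t ^ n * g * (t ^ n)⁻¹ ∈ h.union ∧
      (t ^ n)⁻¹ * g * t ^ n ∈ h.union := by
    intro n
    induction n with
    | zero => intro g hg; simpa using hg
    | succ n ih =>
      intro g hg
      constructor
      · have := (ih _ (h.conj_mem_union hg).1).1
        rw [pow_succ]
        simpa only [mul_inv_rev, mul_assoc] using this
      · have := (ih _ (h.conj_mem_union hg).2).2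
        rw [pow_succ']
        simpa only [mul_inv_rev, mul_assoc] using this
  have hle : U ≤ h.union := fun u hu => h.mem_union.mpr ⟨0, by simpa [conj_one] using hu⟩
  refine ⟨fun g hg y => ?_⟩
  obtain ⟨m, n, hu⟩ := h.exhausts y
  set v := t ^ n * y * (t ^ m)⁻¹ with hv
  have h1 := (hpow m g hg).1
  have h2 := h.union.mul_mem (h.union.mul_mem (hle hu) h1) (h.union.inv_mem (hle hu))
  have h3 := (hpow n _ h2).2
  have e : (t ^ n)⁻¹ * (v * (t ^ m * g * (t ^ m)⁻¹) * v⁻¹) * t ^ n = y * g * y⁻¹ := by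
    rw [hv]; group
  rwa [e] at h3

theorem mul_zpow_mem_union (h : IsContraction U t) (y : G) :
    ∃ k : ℤ, y * t ^ k ∈ h.union := by
  obtain ⟨m, n, hu⟩ := h.exhausts y
  refine ⟨(n : ℤ) - m, h.mem_union.mpr ⟨n, mem_conj.mpr ?_⟩⟩
  have e : (t ^ n)⁻¹⁻¹ * (y * t ^ ((n : ℤ) - m)) * (t ^ n)⁻¹ = t ^ n * y * (t ^ m)⁻¹ := by
    group
  rwa [e]

theorem pow_notMem_union (h : IsContraction U t) {n : ℕ} (hn : n ≠ 0) : t ^ n ∉ h.union := by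
  intro hmem
  obtain ⟨k, hk⟩ := h.mem_union.mp hmem
  rw [mem_conj] at hk
  have e : (t ^ k)⁻¹⁻¹ * t ^ n * (t ^ k)⁻¹ = t ^ n := by group
  rw [e] at hk
  exact h.pow_notMem hn hk

theorem zpow_notMem_union (h : IsContraction U t) {n : ℤ} (hn : n ≠ 0) : t ^ n ∉ h.union := by
  intro hmem
  have hn' : n.natAbs ≠ 0 := by omega
  apply h.pow_notMem_union hn'
  rcases Int.natAbs_eq n with e | e
  · rwa [e, zpow_natCast] at hmem
  · rw [e, zpow_neg, zpow_natCast] at hmem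
    exact (Subgroup.inv_mem_iff _).mp hmem

theorem nonempty_quotient_union (h : IsContraction U t) [h.union.Normal] :
    Nonempty (G ⧸ h.union ≃* Multiplicative ℤ) := by
  refine ⟨(MulEquiv.ofBijective (zpowersHom (G ⧸ h.union) (t : G ⧸ h.union)) ⟨?_, ?_⟩).symm⟩
  · rw [injective_iff_map_eq_one]
    intro n hn
    rw [zpowersHom_apply, ← QuotientGroup.mk_zpow, QuotientGroup.eq_one_iff] at hn
    by_contra hne
    exact h.zpow_notMem_union (fun h0 => hne h0) hn
  · intro y
    induction y using QuotientGroup.induction_on with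
    | H y =>
      obtain ⟨k, hk⟩ := h.mul_zpow_mem_union y
      refine ⟨Multiplicative.ofAdd (-k), ?_⟩
      rw [zpowersHom_apply, ← QuotientGroup.mk_zpow, eq_comm, QuotientGroup.eq, toAdd_ofAdd,
        zpow_neg, ← inv_mem_iff]
      have := h.normal_union.mem_comm hk
      simpa [mul_inv_rev] using this

variable [IsTopologicalGroup G]

theorem isOpen_union (h : IsContraction U t) : IsOpen (h.union : Set G) := by
  have hle : U ≤ h.union := fun u hu => h.mem_union.mpr ⟨0, by simpa [conj_one] using hu⟩
  exact Subgroup.isOpen_mono hle h.isOpen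

/-- The image of `N` in the discrete torsion-free quotient is finite, hence trivial. So `N` lies in
an increasing union of open subgroups, by compactness in one `t⁻ⁿUtⁿ`, by normality in `U`, and thus
in the trivial core. -/
theorem eq_bot_of_isCompact (h : IsContraction U t) {N : Subgroup G} (hN : N.Normal)
    (hc : IsCompact (N : Set G)) : N = ⊥ := by
  have hn := h.normal_union
  have hNH : N ≤ h.union := by
    obtain ⟨e⟩ := h.nonempty_quotient_union
    have : DiscreteTopology (G ⧸ h.union) := QuotientGroup.discreteTopology h.isOpen_union
    have hfin : ((N.map (QuotientGroup.mk' h.union) : Subgroup (G ⧸ h.union)) :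
        Set (G ⧸ h.union)).Finite := by
      apply IsCompact.finite_of_discrete
      exact hc.image QuotientGroup.continuous_mk
    intro g hg
    let K := N.map (QuotientGroup.mk' h.union)
    have : Finite K := hfin.to_subtype
    let gg : K := ⟨QuotientGroup.mk' h.union g, ⟨g, hg, rfl⟩⟩
    have ho : IsOfFinOrder gg := isOfFinOrder_of_finite gg
    have ho2 := (e.toMonoidHom.isOfFinOrder (K.subtype.isOfFinOrder ho))
    rw [isOfFinOrder_iff_eq_one] at ho2
    have : (QuotientGroup.mk' h.union g) = 1 := e.injective (ho2.trans (map_one e).symm)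
    exact (QuotientGroup.eq_one_iff g).mp this
  obtain ⟨n, hNn⟩ : ∃ n : ℕ, (N : Set G) ⊆ conj (t ^ n)⁻¹ U := by
    apply hc.elim_directed_cover _ (fun n => isOpen_conj _ h.isOpen) _
      (conj_pow_inv_mono h.conj_le).directed_le
    intro g hg
    exact Set.mem_iUnion.mpr (h.mem_union.mp (hNH hg))
  rw [eq_bot_iff]
  intro u hu
  refine h.core u fun g => ?_
  have h1 := hNn (hN.conj_mem _ (hN.conj_mem u hu g) (t ^ n)⁻¹)
  rw [SetLike.mem_coe, mem_conj] at h1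
  have e : (t ^ n)⁻¹⁻¹ * ((t ^ n)⁻¹ * (g * u * g⁻¹) * (t ^ n)⁻¹⁻¹) * (t ^ n)⁻¹ = g * u * g⁻¹ := by
    group
  rwa [e] at h1

end IsContraction

variable [IsTopologicalGroup G]

theorem eq_bot_and_exists_of_isContraction {U : Subgroup G} {t : G} (h : IsContraction U t) :
    (∀ N : Subgroup G, N.Normal → IsCompact (N : Set G) → N = ⊥) ∧
      ∃ (H : Subgroup G) (_ : H.Normal), IsOpen (H : Set G) ∧
        Nonempty (G ⧸ H ≃* Multiplicative ℤ) ∧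
        ∃ (V : Subgroup G) (x : G), IsOpen (V : Set G) ∧ IsCompact (V : Set G) ∧
          conj x V < V ∧ (⋃ n : ℤ, (conj (x ^ n) V : Set G)) = (H : Set G) := by
  have hn := h.normal_union
  refine ⟨fun N hN hc => h.eq_bot_of_isCompact hN hc, h.union, hn, h.isOpen_union,
    h.nonempty_quotient_union, U, t, h.isOpen, h.isCompact, h.conj_lt, ?_⟩
  ext g
  rw [mem_iUnion_conj_zpow h.conj_le, SetLike.mem_coe, h.mem_union]

end Conditions

end ScaleGroup

namespace ScaleGroup

/-! ### From the algebraic conditions to a contraction -/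

section Normalisation

variable {G : Type u} [Group G]

/-- The sign of the generator is chosen to make the exponent `k` positive. -/
theorem exists_pow_eq_of_surjective {χ : G →* Multiplicative ℤ} (hχ : Function.Surjective χ)
    {x : G} (hx : χ x ≠ 1) :
    ∃ (t : G) (k : ℕ), 0 < k ∧ χ (t ^ k) = χ x ∧ ∀ g, ∃ j : ℤ, χ g = χ (t ^ j) := by
  obtain ⟨t, ht⟩ := hχ (Multiplicative.ofAdd 1)
  have hz : ∀ y : Multiplicative ℤ, y = χ (t ^ y.toAdd) := fun y => by
    rw [map_zpow, ht, ← ofAdd_zsmul]; simp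
  have hne : (χ x).toAdd ≠ 0 := fun h => hx h
  rcases Int.natAbs_eq (χ x).toAdd with h | h
  · refine ⟨t, (χ x).toAdd.natAbs, by omega, ?_, fun g => ⟨_, hz (χ g)⟩⟩
    rw [← zpow_natCast, ← h, ← hz]
  · refine ⟨t⁻¹, (χ x).toAdd.natAbs, by omega, ?_, fun g => ⟨-(χ g).toAdd, ?_⟩⟩
    · rw [← zpow_natCast, inv_zpow', ← h, ← hz]
    · rw [inv_zpow', neg_neg]; exact hz _

/-- Conjugation by `t` shifts the factors by one; the factor `tᵏWt⁻ᵏ` leaving at the end lies in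
`W`, the one lost at the start. -/
theorem conj_iInf_pow_le {W : Subgroup G} {t : G} {k : ℕ} (h : conj (t ^ k) W ≤ W) :
    conj t (⨅ i : Fin k, conj (t ^ (i : ℕ)) W) ≤ ⨅ i : Fin k, conj (t ^ (i : ℕ)) W := by
  intro y hy
  rw [mem_conj, Subgroup.mem_iInf] at hy
  have hy' : ∀ i < k, y ∈ conj (t ^ (i + 1)) W := fun i hi => by
    have := hy ⟨i, hi⟩
    rw [← mem_conj, ← conj_mul, ← pow_succ'] at this
    exact this
  rw [Subgroup.mem_iInf]
  rintro ⟨i, hi⟩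
  rcases i with _ | i
  · have := h (by simpa [Nat.sub_add_cancel hi] using hy' (k - 1) (by omega))
    simpa [conj_one] using this
  · exact hy' i (by omega)

theorem exists_mem_conj_iInf_pow {W H : Subgroup G} [H.Normal] {t : G} {k : ℕ}
    (h : conj (t ^ k) W ≤ W) (hH : ∀ g ∈ H, ∃ j : ℕ, g ∈ conj ((t ^ k) ^ j)⁻¹ W) {g : G}
    (hg : g ∈ H) : ∃ n : ℕ, g ∈ conj (t ^ n)⁻¹ (⨅ i : Fin k, conj (t ^ (i : ℕ)) W) := by
  have h1 : ∀ i : Fin k, ∃ j : ℕ, (t ^ (i : ℕ))⁻¹ * g * t ^ (i : ℕ) ∈ conj ((t ^ k) ^ j)⁻¹ W :=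
    fun i => hH _ (by simpa using ‹H.Normal›.conj_mem g hg (t ^ (i : ℕ))⁻¹)
  choose j hj using h1
  refine ⟨k * Finset.univ.sup j, ?_⟩
  rw [mem_conj, Subgroup.mem_iInf]
  intro i
  have h2 := conj_pow_inv_mono h (Finset.le_sup (f := j) (Finset.mem_univ i)) (hj i)
  simp only [mem_conj, ← pow_mul] at h2 ⊢
  have e : t ^ (i : ℕ) * (t ^ (k * Finset.univ.sup j))⁻¹
      = (t ^ (k * Finset.univ.sup j))⁻¹ * t ^ (i : ℕ) := by group
  have e' : (t ^ (i : ℕ))⁻¹ * (t ^ (k * Finset.univ.sup j))⁻¹⁻¹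
      = (t ^ (k * Finset.univ.sup j))⁻¹⁻¹ * (t ^ (i : ℕ))⁻¹ := by group
  have e2 : (t ^ (i : ℕ))⁻¹ * ((t ^ (k * Finset.univ.sup j))⁻¹⁻¹ * g *
      (t ^ (k * Finset.univ.sup j))⁻¹) * t ^ (i : ℕ) = (t ^ (k * Finset.univ.sup j))⁻¹⁻¹ *
      ((t ^ (i : ℕ))⁻¹ * g * t ^ (i : ℕ)) * (t ^ (k * Finset.univ.sup j))⁻¹ := by
    calc _ = ((t ^ (i : ℕ))⁻¹ * (t ^ (k * Finset.univ.sup j))⁻¹⁻¹) * g *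
          ((t ^ (k * Finset.univ.sup j))⁻¹ * t ^ (i : ℕ)) := by simp only [mul_assoc]
      _ = _ := by rw [e', ← e]; simp only [mul_assoc]
  rwa [e2]

/-- An element `h⁻¹x` with `h` in `W` moves `W` as `x` does. -/
theorem conj_inv_mul_pow {W : Subgroup G} {x h : G} (hx : conj x W ≤ W) (hh : h ∈ W) (j : ℕ) :
    conj ((h⁻¹ * x) ^ j)⁻¹ W = conj (x ^ j)⁻¹ W := by
  induction j with
  | zero => simp
  | succ j ih =>
    have hj := conj_pow_inv_mono hx j.zero_le
    simp only [pow_zero, inv_one, conj_one] at hj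
    rw [pow_succ, mul_inv_rev, conj_mul, ih, mul_inv_rev, inv_inv, conj_mul x⁻¹ h,
      conj_eq_self (hj hh), ← conj_mul, ← mul_inv_rev, ← pow_succ]

variable [TopologicalSpace G] [IsTopologicalGroup G]

theorem exists_isContraction (hN : ∀ N : Subgroup G, N.Normal → IsCompact (N : Set G) → N = ⊥)
    {H : Subgroup G} [H.Normal] (e : G ⧸ H ≃* Multiplicative ℤ) {V : Subgroup G} {x : G}
    (hV : IsOpen (V : Set G)) (hV' : IsCompact (V : Set G)) (hlt : conj x V < V)
    (hU : (⋃ n : ℤ, (conj (x ^ n) V : Set G)) = (H : Set G)) :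
    ∃ (U : Subgroup G) (t : G), IsContraction U t := by
  have hVH : ∀ g, g ∈ H ↔ ∃ n : ℕ, g ∈ conj (x ^ n)⁻¹ V := fun g => by
    rw [← SetLike.mem_coe, ← hU]; exact mem_iUnion_conj_zpow hlt.le
  let χ : G →* Multiplicative ℤ := e.toMonoidHom.comp (QuotientGroup.mk' H)
  have hχ : Function.Surjective χ := e.surjective.comp (QuotientGroup.mk'_surjective H)
  have hker : ∀ g, χ g = 1 ↔ g ∈ H := fun g => by
    rw [← QuotientGroup.eq_one_iff (N := H) g]
    exact e.map_eq_one_iff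
  have hxH : χ x ≠ 1 := fun h => by
    obtain ⟨n, hn⟩ := (hVH x).mp ((hker x).mp h)
    rw [mem_conj] at hn
    have ee : (x ^ n)⁻¹⁻¹ * x * (x ^ n)⁻¹ = x := by group
    rw [ee] at hn
    exact hlt.ne (conj_eq_self hn)
  obtain ⟨t, k, hk, htk, hgen⟩ := exists_pow_eq_of_surjective hχ hxH
  have hh : x * (t ^ k)⁻¹ ∈ H := by rw [← hker, map_mul, map_inv, htk, mul_inv_cancel]
  obtain ⟨n, hn⟩ := (hVH _).mp hh
  -- `W` is far enough along the chain to contain `xt⁻ᵏ`, so `tᵏ` moves `W` just as `x` does.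
  set W := conj (x ^ n)⁻¹ V with hW
  have hxW : conj x W ≤ W := by
    have e1 : conj x W = conj (x ^ n)⁻¹ (conj x V) := by
      rw [hW, ← conj_mul, ← conj_mul]; congr 1; group
    rw [e1]
    exact conj_mono _ hlt.le
  have htx : t ^ k = (x * (t ^ k)⁻¹)⁻¹ * x := by group
  have htW : conj (t ^ k) W ≤ W := by
    rw [htx, conj_mul]
    calc _ ≤ conj (x * (t ^ k)⁻¹)⁻¹ W := conj_mono _ hxW
      _ = W := conj_eq_self (inv_mem hn)
  have htH : ∀ g ∈ H, ∃ j : ℕ, g ∈ conj ((t ^ k) ^ j)⁻¹ W := by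
    intro g hg
    obtain ⟨j, hj⟩ := (hVH g).mp hg
    refine ⟨j, ?_⟩
    rw [htx, conj_inv_mul_pow hxW hn, hW, ← conj_mul, ← mul_inv_rev, ← pow_add]
    exact conj_pow_inv_mono hlt.le (Nat.le_add_left j n) hj
  set U : Subgroup G := ⨅ i : Fin k, conj (t ^ (i : ℕ)) W with hUdef
  have hUo : IsOpen (U : Set G) := by
    rw [hUdef, Subgroup.coe_iInf]
    exact isOpen_iInter_of_finite fun i => isOpen_conj _ (isOpen_conj _ hV)
  have hUc : IsCompact (U : Set G) := by
    refine (isCompact_conj (x ^ n)⁻¹ hV').of_isClosed_subset (U.isClosed_of_isOpen hUo) ?_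
    have := iInf_le (fun i : Fin k => conj (t ^ (i : ℕ)) W) ⟨0, hk⟩
    simpa [conj_one] using this
  have hUt : conj t U ≤ U := conj_iInf_pow_le htW
  have hUH : ∀ g ∈ H, ∃ n : ℕ, g ∈ conj (t ^ n)⁻¹ U := fun g hg =>
    exists_mem_conj_iInf_pow htW htH hg
  refine ⟨U, t, hUo, hUc, hUt, ?_, ?_, ?_⟩
  · have h0 := relIndex_ne_zero_of_isOpen_of_isCompact (isOpen_conj t hUo) hUc
    -- Index one would make the chain constant, so `H ≤ U` would be a compact normal subgroup, hence
    -- trivial, and `V ≤ H` could not contain a proper subgroup.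
    have h1 : (conj t U).relIndex U ≠ 1 := by
      intro h1
      have heq : conj t U = U := le_antisymm hUt (Subgroup.relIndex_eq_one.mp h1)
      have hn' : ∀ n : ℕ, conj (t ^ n)⁻¹ U = U := by
        have h1 : conj t⁻¹ U = U := by
          conv_lhs => rw [← heq, ← conj_mul, inv_mul_cancel, conj_one]
        intro n
        induction n with
        | zero => simp [conj_one]
        | succ n ih => rw [pow_succ, mul_inv_rev, conj_mul, ih, h1]
      have hHU : H ≤ U := fun g hg => by
        obtain ⟨n, hn⟩ := hUH g hg
        rwa [hn'] at hn
      have hVle : V ≤ H := fun v hv => (hVH v).mpr ⟨0, by simpa [conj_one] using hv⟩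
      have hHc : IsCompact (H : Set G) :=
        hUc.of_isClosed_subset (H.isClosed_of_isOpen (Subgroup.isOpen_mono hVle hV)) hHU
      have hb := hN H inferInstance hHc
      rw [hb, le_bot_iff] at hVle
      rw [hVle] at hlt
      exact not_lt_bot hlt
    omega
  · intro g
    obtain ⟨j, hj⟩ := hgen g
    have hgj : g * (t ^ j)⁻¹ ∈ H := by rw [← hker, map_mul, map_inv, hj, mul_inv_cancel]
    obtain ⟨n, hn⟩ := hUH _ hgj
    have hn2 := conj_pow_inv_mono hUt (Nat.le_add_right n j.natAbs) hn
    simp only [mem_conj] at hn2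
    -- Adding `|j|` keeps both exponents non-negative.
    refine ⟨(n + j.natAbs + j).toNat, n + j.natAbs, ?_⟩
    have e1 : t ^ (n + j.natAbs + j).toNat = t ^ (n + j.natAbs) * t ^ j := by
      rw [← zpow_natCast, Int.toNat_of_nonneg (by omega), zpow_add, ← zpow_natCast]
      push_cast
      rfl
    rw [e1]
    simpa only [mul_inv_rev, inv_inv, mul_assoc] using hn2
  · intro u hu
    have hc : IsCompact (U.normalCore : Set G) := by
      refine hUc.of_isClosed_subset ?_ U.normalCore_le
      have : (U.normalCore : Set G) = ⋂ g : G, (fun u => g * u * g⁻¹) ⁻¹' (U : Set G) := by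
        ext u
        simp [Subgroup.normalCore]
      rw [this]
      exact isClosed_iInter fun g => (U.isClosed_of_isOpen hUo).preimage (by fun_prop)
    have hb := hN _ inferInstance hc
    have : u ∈ U.normalCore := hu
    rwa [hb, Subgroup.mem_bot] at this

end Normalisation

end ScaleGroup

namespace ScaleGroup

/-! ### Trees defined by a parent map -/

section ParentGraph

variable {V : Type u}

/-- The graph joining every vertex to its parent. -/
def parentGraph (p : V → V) : SimpleGraph V := SimpleGraph.fromRel fun a b => p a = b

variable {p : V → V}

theorem parentGraph_adj (hp : ∀ v n, p^[n + 1] v ≠ v) {a b : V} :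
    (parentGraph p).Adj a b ↔ p a = b ∨ p b = a := by
  rw [parentGraph, SimpleGraph.fromRel_adj, and_iff_right_of_imp]
  rintro h rfl
  exact hp a 0 (by simpa using h)

theorem reachable_iterate (hp : ∀ v n, p^[n + 1] v ≠ v) (v : V) (n : ℕ) :
    (parentGraph p).Reachable v (p^[n] v) := by
  induction n with
  | zero => exact SimpleGraph.Reachable.refl _
  | succ n ih =>
    refine ih.trans (SimpleGraph.Adj.reachable ?_)
    rw [parentGraph_adj hp, Function.iterate_succ_apply']
    exact Or.inl rfl

/-- Once the edge from `v` to its parent is removed, no edge leaves the set of descendants of `v`.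
Hence that edge is a bridge: `p v` is no descendant, as `p` has no cycles. -/
theorem descendant_of_reachable (hp : ∀ v n, p^[n + 1] v ≠ v) {v w : V}
    (h : ((parentGraph p).deleteEdges {s(v, p v)}).Reachable v w) : ∃ k, p^[k] w = v := by
  obtain ⟨W⟩ := h
  suffices H : ∀ {a b : V} (_ : ((parentGraph p).deleteEdges {s(v, p v)}).Walk a b),
      (∃ k, p^[k] a = v) → ∃ k, p^[k] b = v from H W ⟨0, rfl⟩
  intro a b W
  induction W with
  | nil => exact id
  | cons hadj _ ih =>
    rintro ⟨k, hk⟩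
    apply ih
    rw [SimpleGraph.deleteEdges_adj, parentGraph_adj hp] at hadj
    obtain ⟨h1 | h1, h2⟩ := hadj
    · rcases k with _ | k
      · simp only [Function.iterate_zero, id_eq] at hk
        subst hk
        subst h1
        exact absurd rfl h2
      · exact ⟨k, by rw [← h1, ← Function.iterate_succ_apply, hk]⟩
    · exact ⟨k + 1, by rw [Function.iterate_succ_apply, h1, hk]⟩

theorem isTree_parentGraph [Nonempty V] (hp : ∀ v n, p^[n + 1] v ≠ v)
    (hc : ∀ v w, ∃ m n, p^[m] v = p^[n] w) : (parentGraph p).IsTree := by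
  refine ⟨⟨fun v w => ?_⟩, SimpleGraph.isAcyclic_iff_forall_adj_isBridge.mpr fun v w h => ?_⟩
  · obtain ⟨m, n, h⟩ := hc v w
    have := reachable_iterate hp v m
    rw [h] at this
    exact this.trans (reachable_iterate hp w n).symm
  · have key : ∀ a, (parentGraph p).IsBridge s(a, p a) := fun a => by
      rw [SimpleGraph.isBridge_iff]
      intro hr
      obtain ⟨k, hk⟩ := descendant_of_reachable hp hr
      exact hp a k hk
    rcases (parentGraph_adj hp).mp h with rfl | rfl
    · exact key v
    · rw [Sym2.eq_swap]; exact key w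

theorem encard_neighborSet_parentGraph (hp : ∀ v n, p^[n + 1] v ≠ v) (v : V) :
    ((parentGraph p).neighborSet v).encard = (p ⁻¹' {v}).encard + 1 := by
  rw [← Set.encard_insert_of_notMem (a := p v)]
  · congr 1
    ext w
    simp [parentGraph_adj hp, eq_comm]
  · exact hp v 1

/-- The ray of ancestors of a vertex. -/
def ancestorRay (hp : ∀ v n, p^[n + 1] v ≠ v) (v : V) : Ray (parentGraph p) where
  toFun n := p^[n] v
  adj n := (parentGraph_adj hp).mpr (Or.inl (Function.iterate_succ_apply' p n v).symm)
  inj := by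
    have key : ∀ m k, p^[m] v ≠ p^[m + (k + 1)] v := fun m k h => by
      rw [add_comm, Function.iterate_add_apply] at h
      exact hp _ k h.symm
    intro m n h
    rcases lt_trichotomy m n with hmn | hmn | hmn
    · obtain ⟨k, rfl⟩ := Nat.exists_eq_add_of_lt hmn
      exact absurd h (key m k)
    · exact hmn
    · obtain ⟨k, rfl⟩ := Nat.exists_eq_add_of_lt hmn
      exact absurd h.symm (key n k)

end ParentGraph

/-! ### The permutation topology on automorphisms -/

section Topology

open Topology

variable {V : Type u} {T : SimpleGraph V}

theorem isOpen_setOf_apply_eq (v w : V) : IsOpen {f : T ≃g T | f v = w} := by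
  let _ : TopologicalSpace V := ⊥
  have : DiscreteTopology V := ⟨rfl⟩
  have h : Continuous fun f : T ≃g T => (f : V → V) := continuous_induced_dom
  exact (isOpen_discrete {w}).preimage ((continuous_apply v).comp h)

instance t2Space_isom : T2Space (T ≃g T) := by
  let _ : TopologicalSpace V := ⊥
  have : DiscreteTopology V := ⟨rfl⟩
  have h : Continuous fun f : T ≃g T => (f : V → V) := continuous_induced_dom
  exact T2Space.of_injective_continuous DFunLike.coe_injective h

theorem continuous_isom_iff {X : Type*} [TopologicalSpace X] {f : X → (T ≃g T)} :
    Continuous f ↔ ∀ v w, IsOpen {x | f x v = w} := by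
  let _ : TopologicalSpace V := ⊥
  have : DiscreteTopology V := ⟨rfl⟩
  constructor
  · exact fun hf v w => (isOpen_setOf_apply_eq v w).preimage hf
  · intro h
    rw [continuous_induced_rng, continuous_pi_iff]
    exact fun v => continuous_discrete_rng.mpr fun w => h v w

/-- The open sets `{f | f v = w}` cover the target, and over each of them the map is a continuous
injection from a compact space to a Hausdorff one. -/
theorem isClosedEmbedding_isom {X : Type*} [TopologicalSpace X] {f : X → (T ≃g T)}
    (hf : Continuous f) (hinj : Function.Injective f) (v : V)
    (hc : ∀ w, IsCompact {x | f x v = w}) : IsClosedEmbedding f := by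
  have hcov : TopologicalSpace.IsOpenCover fun w : V =>
      (⟨{f : T ≃g T | f v = w}, isOpen_setOf_apply_eq v w⟩ : TopologicalSpace.Opens (T ≃g T)) :=
    TopologicalSpace.IsOpenCover.mk (by ext g; simp)
  rw [hcov.isClosedEmbedding_iff_restrictPreimage hf]
  intro w
  have : CompactSpace (f ⁻¹' {f : T ≃g T | f v = w}) := isCompact_iff_compactSpace.mp (hc w)
  exact (hf.restrictPreimage).isClosedEmbedding (hinj.restrictPreimage _)

theorem nonempty_continuousMulEquiv_range {G K : Type*} [Group G] [TopologicalSpace G] [Group K]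
    [TopologicalSpace K] {f : G →* K} (hf : IsClosedEmbedding f) : Nonempty (G ≃ₜ* f.range) := by
  refine ⟨{ MonoidHom.ofInjective hf.injective with
    continuous_toFun := hf.continuous.subtype_mk _
    continuous_invFun := ?_ }⟩
  rw [hf.isInducing.continuous_iff]
  have h : f ∘ (MonoidHom.ofInjective hf.injective).symm = Subtype.val := by
    ext y
    exact MonoidHom.apply_ofInjective_symm hf.injective y
  exact h ▸ continuous_subtype_val

end Topology

/-! ### The coset tree of a contraction -/

section CosetTree

variable {G : Type u} [Group G]

theorem relIndex_stabilizer {V : Type*} [MulAction G V] (a b : V) :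
    (MulAction.stabilizer G b).relIndex (MulAction.stabilizer G a) =
      {c | ∃ g : G, g • a = a ∧ g • b = c}.ncard := by
  have h : {c | ∃ g : G, g • a = a ∧ g • b = c} =
      MulAction.orbit (MulAction.stabilizer G a) b := by
    ext c
    constructor
    · rintro ⟨g, hg, hc⟩
      exact ⟨⟨g, hg⟩, hc⟩
    · rintro ⟨⟨g, hg⟩, hc⟩
      exact ⟨g, hg, hc⟩
  rw [h, ← MulAction.index_stabilizer, Subgroup.relIndex]
  rfl

/-- Right translation of cosets by `t⁻¹`, for `t` normalising `U` into itself. -/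
def cosetParent {U : Subgroup G} {t : G} (h : conj t U ≤ U) : G ⧸ U → G ⧸ U :=
  Quotient.map' (fun g => g * t⁻¹) fun a b hab => by
    rw [QuotientGroup.leftRel_apply] at hab ⊢
    apply h
    rw [mem_conj]
    have e : t⁻¹ * ((a * t⁻¹)⁻¹ * (b * t⁻¹)) * t = a⁻¹ * b := by group
    rwa [e]

variable {U : Subgroup G} {t : G}

theorem cosetParent_mk (h : conj t U ≤ U) (g : G) :
    cosetParent h (g : G ⧸ U) = ((g * t⁻¹ : G) : G ⧸ U) := rfl

theorem cosetParent_smul (h : conj t U ≤ U) (g : G) (v : G ⧸ U) :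
    cosetParent h (g • v) = g • cosetParent h v := by
  induction v using QuotientGroup.induction_on with
  | H a => rw [MulAction.Quotient.smul_coe, cosetParent_mk, cosetParent_mk,
      MulAction.Quotient.smul_coe, smul_eq_mul, smul_eq_mul, mul_assoc]

theorem iterate_cosetParent_mk (h : conj t U ≤ U) (n : ℕ) (g : G) :
    (cosetParent h)^[n] (g : G ⧸ U) = ((g * (t ^ n)⁻¹ : G) : G ⧸ U) := by
  induction n with
  | zero => simp
  | succ n ih => rw [Function.iterate_succ_apply', ih, cosetParent_mk, pow_succ', mul_inv_rev,
      mul_assoc]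

/-- The children of the coset `U` form the `U`-orbit of `tU`, whose stabiliser in `U` is `tUt⁻¹`;
the other fibres are translates. -/
theorem encard_cosetParent_fiber (h : conj t U ≤ U) (h0 : (conj t U).relIndex U ≠ 0)
    (v : G ⧸ U) : (cosetParent h ⁻¹' {v}).encard = (conj t U).relIndex U := by
  have hst : ∀ g : G, MulAction.stabilizer G (g : G ⧸ U) = conj g U := fun g => by
    ext y
    rw [MulAction.mem_stabilizer_iff, MulAction.Quotient.smul_coe, eq_comm, QuotientGroup.eq,
      mem_conj, smul_eq_mul, mul_assoc]
  have hfib : cosetParent h ⁻¹' {((1 : G) : G ⧸ U)} =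
      {w | ∃ g : G, g • ((1 : G) : G ⧸ U) = ((1 : G) : G ⧸ U) ∧ g • (t : G ⧸ U) = w} := by
    ext w
    induction w using QuotientGroup.induction_on with
    | H a =>
      rw [Set.mem_preimage, Set.mem_singleton_iff, cosetParent_mk, eq_comm, QuotientGroup.eq]
      constructor
      · intro ha
        refine ⟨a * t⁻¹, ?_, ?_⟩
        · rw [← MulAction.mem_stabilizer_iff, hst, conj_one]
          simpa using ha
        · rw [MulAction.Quotient.smul_coe]
          simp
      · rintro ⟨y, hy, hya⟩
        rw [← MulAction.mem_stabilizer_iff, hst, conj_one] at hy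
        rw [MulAction.Quotient.smul_coe, QuotientGroup.eq] at hya
        have h1 : t * ((y • t)⁻¹ * a) * t⁻¹ ∈ U :=
          h (mem_conj.mpr (by simpa [mul_assoc] using hya))
        have := U.mul_mem hy h1
        simpa [mul_assoc] using this
  have hone : (cosetParent h ⁻¹' {((1 : G) : G ⧸ U)}).encard = (conj t U).relIndex U := by
    have e := relIndex_stabilizer (G := G) ((1 : G) : G ⧸ U) (t : G ⧸ U)
    rw [← hfib, hst, hst, conj_one] at e
    have hfin : (cosetParent h ⁻¹' {((1 : G) : G ⧸ U)}).Finite :=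
      Set.finite_of_ncard_ne_zero (by rw [← e]; exact h0)
    rw [e, hfin.cast_ncard_eq]
  rw [← hone]
  induction v using QuotientGroup.induction_on with
  | H g =>
    have him : cosetParent h ⁻¹' {(g : G ⧸ U)} =
        (fun w => g • w) '' (cosetParent h ⁻¹' {((1 : G) : G ⧸ U)}) := by
      ext w
      rw [Set.mem_image]
      constructor
      · intro hw
        refine ⟨g⁻¹ • w, ?_, smul_inv_smul g w⟩
        rw [Set.mem_preimage, Set.mem_singleton_iff] at hw ⊢
        rw [cosetParent_smul, hw, MulAction.Quotient.smul_coe, smul_eq_mul, inv_mul_cancel]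
      · rintro ⟨w, hw, rfl⟩
        rw [Set.mem_preimage, Set.mem_singleton_iff] at hw ⊢
        rw [cosetParent_smul, hw, MulAction.Quotient.smul_coe, smul_eq_mul, mul_one]
    rw [him, (MulAction.injective g).encard_image]

variable [TopologicalSpace G]

namespace IsContraction

theorem iterate_cosetParent_ne (h : IsContraction U t) (v : G ⧸ U) (n : ℕ) :
    (cosetParent h.conj_le)^[n + 1] v ≠ v := by
  induction v using QuotientGroup.induction_on with
  | H g =>
    rw [iterate_cosetParent_mk, Ne, QuotientGroup.eq]
    intro hm
    apply h.pow_notMem n.succ_ne_zero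
    simpa using hm

theorem exists_iterate_cosetParent_eq (h : IsContraction U t) (v w : G ⧸ U) :
    ∃ m n, (cosetParent h.conj_le)^[m] v = (cosetParent h.conj_le)^[n] w := by
  induction v using QuotientGroup.induction_on with
  | H a =>
    induction w using QuotientGroup.induction_on with
    | H b =>
      obtain ⟨m, n, hu⟩ := h.exhausts (a⁻¹ * b)
      refine ⟨n, m, ?_⟩
      rw [iterate_cosetParent_mk, iterate_cosetParent_mk, QuotientGroup.eq]
      simpa [mul_assoc] using hu

/-- The action of the group on the coset tree. -/
def toIsom (h : IsContraction U t) :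
    G →* (parentGraph (cosetParent h.conj_le) ≃g parentGraph (cosetParent h.conj_le)) where
  toFun g :=
    { toEquiv := MulAction.toPerm g
      map_rel_iff' := by
        intro a b
        simp [parentGraph_adj h.iterate_cosetParent_ne, cosetParent_smul] }
  map_one' := by ext v; exact one_smul G v
  map_mul' a b := by ext v; exact mul_smul a b v

theorem toIsom_apply (h : IsContraction U t) (g : G) (v : G ⧸ U) : h.toIsom g v = g • v := rfl

theorem toIsom_injective (h : IsContraction U t) : Function.Injective h.toIsom := by
  rw [injective_iff_map_eq_one]
  intro u hu
  refine h.core u fun g => ?_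
  have h1 : u • ((g⁻¹ : G) : G ⧸ U) = ((g⁻¹ : G) : G ⧸ U) := by
    rw [← h.toIsom_apply, hu]; rfl
  rw [MulAction.Quotient.smul_coe, eq_comm, QuotientGroup.eq] at h1
  simpa [mul_assoc] using h1

variable [IsTopologicalGroup G]

theorem isClosedEmbedding_toIsom (h : IsContraction U t) :
    Topology.IsClosedEmbedding h.toIsom := by
  -- These sets are the translates `bUa⁻¹`: openness gives continuity, compactness gives the closed
  -- embedding.
  have hset : ∀ a b : G, {g : G | h.toIsom g (a : G ⧸ U) = (b : G ⧸ U)} =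
      (fun u => b * u * a⁻¹) '' (U : Set G) := fun a b => by
    ext g
    rw [Set.mem_ofPred_eq, toIsom_apply, MulAction.Quotient.smul_coe, eq_comm, QuotientGroup.eq]
    constructor
    · intro hg
      exact ⟨_, hg, by simp [mul_assoc]⟩
    · rintro ⟨u, hu, rfl⟩
      simpa [mul_assoc] using hu
  refine isClosedEmbedding_isom ?_ h.toIsom_injective ((1 : G) : G ⧸ U) ?_
  · rw [continuous_isom_iff]
    intro v w
    induction v using QuotientGroup.induction_on with
    | H a =>
      induction w using QuotientGroup.induction_on with
      | H b =>
        rw [hset]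
        exact ((Homeomorph.mulRight a⁻¹).isOpenMap.comp (Homeomorph.mulLeft b).isOpenMap) _ h.isOpen
  · intro w
    induction w using QuotientGroup.induction_on with
    | H b =>
      rw [hset]
      exact h.isCompact.image (by fun_prop)

/-- A group with a contracted compact open subgroup is a scale group on its coset tree. -/
theorem hasFaithfulScaleRep (h : IsContraction U t) :
    HasFaithfulScaleRep G ((conj t U).relIndex U) := by
  have hp := h.iterate_cosetParent_ne
  have hemb := h.isClosedEmbedding_toIsom
  refine ⟨G ⧸ U, parentGraph (cosetParent h.conj_le),
    Quotient.mk _ (ancestorRay hp ((1 : G) : G ⧸ U)), h.toIsom.range, ⟨?_, ?_⟩, ⟨?_, ?_, ?_⟩, ?_⟩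
  · exact isTree_parentGraph hp h.exists_iterate_cosetParent_eq
  · intro v
    rw [encard_neighborSet_parentGraph hp, encard_cosetParent_fiber h.conj_le
      (by have := h.two_le; omega)]
    push_cast
    rfl
  · rw [MonoidHom.coe_range]
    exact hemb.isClosed_range
  · rintro _ ⟨g, rfl⟩
    refine Quotient.sound ?_
    -- The image of an ancestor ray is again an ancestor ray, and any two of these merge.
    obtain ⟨m, n, hmn⟩ := h.exists_iterate_cosetParent_eq (g • ((1 : G) : G ⧸ U)) ((1 : G) : G ⧸ U)
    refine ⟨m, n, fun k => ?_⟩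
    have hg : ∀ j (v : G ⧸ U), g • (cosetParent h.conj_le)^[j] v
        = (cosetParent h.conj_le)^[j] (g • v) := fun j v =>
      ((Function.Semiconj.iterate_right (f := fun w : G ⧸ U => g • w)
        (fun w => (cosetParent_smul h.conj_le g w).symm) j) v)
    change g • (cosetParent h.conj_le)^[m + k] _ = (cosetParent h.conj_le)^[n + k] _
    rw [hg, add_comm m, add_comm n, Function.iterate_add_apply, hmn, Function.iterate_add_apply]
  · intro v w
    obtain ⟨g, hg⟩ := MulAction.exists_smul_eq G v w
    exact ⟨h.toIsom g, ⟨g, rfl⟩, hg⟩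
  · exact nonempty_continuousMulEquiv_range hemb

end IsContraction

end CosetTree

end ScaleGroup

namespace ScaleGroup

/-! ### The parent map of an end -/

section Rays

variable {V : Type u} {T : SimpleGraph V}

namespace Ray

/-- The initial segment of a ray. -/
def walk (r : Ray T) : ∀ n, T.Walk (r.toFun 0) (r.toFun n)
  | 0 => .nil
  | n + 1 => (r.walk n).concat (r.adj n)

theorem support_walk (r : Ray T) (n : ℕ) :
    (r.walk n).support = (List.range (n + 1)).map r.toFun := by
  induction n with
  | zero => simp [walk]
  | succ n ih => rw [walk, SimpleGraph.Walk.support_concat, ih, List.range_succ (n := n + 1)]; simp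

theorem isPath_walk (r : Ray T) (n : ℕ) : (r.walk n).IsPath := by
  rw [SimpleGraph.Walk.isPath_def, support_walk]
  exact List.nodup_range.map r.inj

theorem support_eq_of_isPath (hT : T.IsAcyclic) (r : Ray T) {v w : V} {n : ℕ} (W : T.Walk v w)
    (hW : W.IsPath) (hv : r.toFun 0 = v) (hw : r.toFun n = w) :
    W.support = (List.range (n + 1)).map r.toFun := by
  subst hv hw
  rw [← support_walk]
  have h := (hT.subsingleton_path _ _).elim ⟨W, hW⟩ ⟨_, r.isPath_walk n⟩
  exact congrArg SimpleGraph.Walk.support (congrArg Subtype.val h)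

/-- Up to the start of the common tail both rays trace the unique path between the same two
vertices, so the two shifts agree. -/
theorem toFun_eq_of_equiv (hT : T.IsAcyclic) {r s : Ray T} (h : r ≈ s)
    (h0 : r.toFun 0 = s.toFun 0) (n : ℕ) : r.toFun n = s.toFun n := by
  obtain ⟨a, b, hab⟩ := h
  have h1 := s.support_eq_of_isPath hT (r.walk a) (r.isPath_walk a) h0.symm (hab 0).symm
  rw [support_walk] at h1
  have hl := congrArg List.length h1
  simp only [List.length_map, List.length_range, add_zero, add_left_inj] at hl
  subst hl
  rcases le_or_gt n a with hn | hn
  · rw [List.map_inj_left] at h1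
    exact h1 n (by simpa using Nat.lt_succ_of_le hn)
  · obtain ⟨k, rfl⟩ := Nat.exists_eq_add_of_lt hn
    exact hab (k + 1)

/-- The ray without its first vertex. -/
def tail (r : Ray T) : Ray T where
  toFun n := r.toFun (n + 1)
  adj n := r.adj (n + 1)
  inj _ _ h := Nat.succ_injective (r.inj h)

theorem tail_equiv (r : Ray T) : r.tail ≈ r := ⟨0, 1, fun k => by simp [tail, add_comm]⟩

/-- The ray with a further vertex in front. -/
def cons (r : Ray T) (v : V) (h : T.Adj v (r.toFun 0)) (hv : ∀ n, r.toFun n ≠ v) : Ray T where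
  toFun n := Nat.casesOn n v r.toFun
  adj n := by
    cases n with
    | zero => exact h
    | succ n => exact r.adj n
  inj m n hmn := by
    rcases m with _ | m <;> rcases n with _ | n
    · rfl
    · exact absurd hmn.symm (hv n)
    · exact absurd hmn (hv m)
    · exact congrArg _ (r.inj hmn)

theorem cons_equiv (r : Ray T) (v : V) (h : T.Adj v (r.toFun 0)) (hv : ∀ n, r.toFun n ≠ v) :
    r.cons v h hv ≈ r := ⟨1, 0, fun k => by simp [cons, add_comm 1 k]⟩

end Ray

/-- An end of a tree met by a ray from every vertex comes from a parent map, and the parent map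
is preserved by all automorphisms fixing the end. -/
theorem exists_parent (hT : T.IsAcyclic) (ω : TreeEnd T)
    (hω : ∀ v, ∃ r : Ray T, r.toFun 0 = v ∧ Quotient.mk _ r = ω) :
    ∃ p : V → V, (∀ v n, p^[n + 1] v ≠ v) ∧ (∀ v w, ∃ m n, p^[m] v = p^[n] w) ∧
      T = parentGraph p ∧ ∀ f : T ≃g T, TreeEnd.map f ω = ω → ∀ v, p (f v) = f (p v) := by
  choose R hR0 hRω using hω
  have huniq : ∀ v (r : Ray T), r.toFun 0 = v → Quotient.mk _ r = ω →
      ∀ n, r.toFun n = (R v).toFun n := fun v r h0 hr n =>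
    Ray.toFun_eq_of_equiv hT (Quotient.exact (hr.trans (hRω v).symm)) (h0.trans (hR0 v).symm) n
  let p : V → V := fun v => (R v).toFun 1
  have hit : ∀ n v, p^[n] v = (R v).toFun n := by
    intro n
    induction n with
    | zero => exact fun v => (hR0 v).symm
    | succ n ih =>
      intro v
      rw [Function.iterate_succ_apply, ih]
      exact (huniq (p v) (R v).tail rfl ((Quotient.sound (R v).tail_equiv).trans (hRω v)) n).symm
  have hp : ∀ v n, p^[n + 1] v ≠ v := fun v n h => by
    rw [hit] at h
    exact n.succ_ne_zero ((R v).inj (h.trans (hR0 v).symm))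
  refine ⟨p, hp, fun v w => ?_, ?_, fun f hf v => ?_⟩
  · obtain ⟨m, n, h⟩ := Quotient.exact ((hRω v).trans (hRω w).symm)
    exact ⟨m, n, by rw [hit, hit]; exact h 0⟩
  · have hadj : ∀ v, T.Adj v (p v) := fun v => by
      have := (R v).adj 0
      rwa [hR0] at this
    ext v w
    rw [parentGraph_adj hp]
    constructor
    · intro hvw
      -- If `w` is on the ray from `v`, uniqueness of paths puts it at position `1`, so `w = p v`.
      -- If not, prefixing `w` gives the ray from `w`, so `p w = v`.
      by_cases hk : ∃ k, (R v).toFun k = w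
      · obtain ⟨k, hk⟩ := hk
        left
        have hpath : hvw.toWalk.IsPath := by
          simp [SimpleGraph.Walk.isPath_def, hvw.ne]
        have hs := congrArg List.length ((R v).support_eq_of_isPath hT _ hpath (hR0 v) hk)
        simp only [SimpleGraph.Walk.length_support, List.length_map, List.length_range,
          add_left_inj] at hs
        have hk1 : k = 1 := by simpa using hs.symm
        rw [← hk, hk1]
      · right
        rw [not_exists] at hk
        have hwv : T.Adj w ((R v).toFun 0) := by rw [hR0]; exact hvw.symm
        have := huniq w ((R v).cons w hwv hk) rfl
          ((Quotient.sound ((R v).cons_equiv w hwv hk)).trans (hRω v)) 1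
        exact this.symm.trans (hR0 v)
    · rintro (rfl | rfl)
      · exact hadj v
      · exact (hadj w).symm
  · refine (huniq (f v) (Ray.map f (R v)) (congrArg f (hR0 v)) ?_ 1).symm
    rw [← hf]
    conv_rhs => rw [← hRω v]
    rfl

end Rays

/-! ### Compactness of vertex stabilisers -/

section Stabiliser

open Topology

variable {V : Type u} {T : SimpleGraph V}

theorem finite_setOf_walk_length (hT : ∀ v, (T.neighborSet v).Finite) (n : ℕ) (v : V) :
    {w | ∃ W : T.Walk v w, W.length = n}.Finite := by
  induction n generalizing v with
  | zero =>
    refine (Set.finite_singleton v).subset ?_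
    rintro w ⟨W, hW⟩
    exact (SimpleGraph.Walk.eq_of_length_eq_zero hW).symm
  | succ n ih =>
    refine ((hT v).biUnion fun u _ => ih u).subset ?_
    rintro w ⟨W, hW⟩
    cases W with
    | nil => simp at hW
    | cons h W =>
      exact Set.mem_biUnion h ⟨W, by simpa using hW⟩

theorem isCompact_setOf_apply_eq_self (hT : ∀ v, (T.neighborSet v).Finite) (hconn : T.Connected)
    (v₀ : V) : IsCompact {f : T ≃g T | f v₀ = v₀} := by
  let _ : TopologicalSpace V := ⊥
  have : DiscreteTopology V := ⟨rfl⟩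
  -- The inverse is recorded too because surjectivity is not a closed condition on the map alone,
  -- whereas being mutually inverse is.
  let Φ : (T ≃g T) → (V → V) × (V → V) := fun f => (f, f.symm)
  have hcoe : IsInducing fun f : T ≃g T => (f : V → V) := ⟨rfl⟩
  have hΦc : Continuous Φ := by
    refine hcoe.continuous.prodMk (continuous_pi fun v => continuous_discrete_rng.mpr fun w => ?_)
    have : (fun f : T ≃g T => f.symm v) ⁻¹' {w} = {f | f w = v} := by
      ext f
      exact f.toEquiv.symm_apply_eq.trans eq_comm
    rw [this]
    exact isOpen_setOf_apply_eq w v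
  have hΦi : IsInducing Φ := IsInducing.of_comp hΦc continuous_fst hcoe
  have hrange : Set.range Φ = {x | (∀ v w, x.2 v = w ↔ x.1 w = v) ∧
      ∀ v w, T.Adj (x.1 v) (x.1 w) ↔ T.Adj v w} := by
    ext ⟨a, b⟩
    constructor
    · rintro ⟨f, hf⟩
      simp only [Φ, Prod.mk.injEq] at hf
      obtain ⟨rfl, rfl⟩ := hf
      exact ⟨fun v w => f.toEquiv.symm_apply_eq.trans eq_comm, fun v w => f.map_rel_iff⟩
    · rintro ⟨h1, h2⟩
      exact ⟨⟨⟨a, b, fun v => (h1 _ _).mpr rfl, fun v => (h1 _ _).mp rfl⟩, h2 _ _⟩, rfl⟩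
  have hclopen : ∀ (S : Set (V × V)) (v w : V) (g h : (V → V) × (V → V) → V → V),
      Continuous g → Continuous h → IsClopen {x : (V → V) × (V → V) | (g x v, h x w) ∈ S} :=
    fun S v w g h hg hh => (isClopen_discrete S).preimage
      (((continuous_apply v).comp hg).prodMk ((continuous_apply w).comp hh))
  have hiff : ∀ {X : Type u} [TopologicalSpace X] {A B : X → Prop}, IsClopen {x | A x} →
      IsClopen {x | B x} → IsClosed {x | A x ↔ B x} := fun {X} _ {A B} hA hB => by
    have : {x | A x ↔ B x} = ({x | A x}ᶜ ∪ {x | B x}) ∩ ({x | B x}ᶜ ∪ {x | A x}) := by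
      ext x
      simp only [Set.mem_inter_iff, Set.mem_union, Set.mem_compl_iff, Set.mem_ofPred_eq]
      tauto
    rw [this]
    exact ((hA.compl.union hB).inter (hB.compl.union hA)).isClosed
  have hclosed : IsClosed (Set.range Φ) := by
    rw [hrange, Set.ofPred_and]
    refine IsClosed.inter ?_ ?_
    · simp only [Set.ofPred_forall]
      refine isClosed_iInter fun v => isClosed_iInter fun w => hiff ?_ ?_
      · exact hclopen {z | z.1 = w} v v _ _ continuous_snd continuous_snd
      · exact hclopen {z | z.1 = v} w w _ _ continuous_fst continuous_fst
    · simp only [Set.ofPred_forall]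
      refine isClosed_iInter fun v => isClosed_iInter fun w => hiff
        (hclopen {z | T.Adj z.1 z.2} v w _ _ continuous_fst continuous_fst)
        (hclopen {_z | T.Adj v w} v w _ _ continuous_fst continuous_fst)
  have hΦ : IsClosedEmbedding Φ :=
    ⟨⟨hΦi, fun f g h => DFunLike.coe_injective (congrArg Prod.fst h)⟩, hclosed⟩
  -- Automorphisms fixing `v₀` preserve lengths of walks from it, so each vertex has finitely many
  -- possible images and Tychonoff applies.
  let B : V → Set V := fun v => {w | ∃ W : T.Walk v₀ w, W.length = (hconn v₀ v).some.length}
  have hB : IsCompact (Set.pi Set.univ B) :=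
    isCompact_univ_pi fun v => (finite_setOf_walk_length hT _ _).isCompact
  have hmem : ∀ f : T ≃g T, f v₀ = v₀ → (f : V → V) ∈ Set.pi Set.univ B := fun f hf v _ =>
    ⟨((hconn v₀ v).some.map f.toHom).copy hf rfl, by simp⟩
  refine (hΦ.isCompact_preimage (hB.prod hB)).of_isClosed_subset ?_ ?_
  · have : {f : T ≃g T | f v₀ = v₀} = (fun f : T ≃g T => (f : V → V) v₀) ⁻¹' {v₀} := rfl
    rw [this]
    exact (isClosed_discrete _).preimage ((continuous_apply v₀).comp hcoe.continuous)
  · exact fun f hf => ⟨hmem f hf, hmem f.symm ((f.toEquiv.symm_apply_eq).mpr hf.symm)⟩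

end Stabiliser

/-! ### From a scale group to a contraction -/

section Action

variable {G : Type u} [Group G]

theorem stabilizer_smul_eq_conj {V : Type*} [MulAction G V] (g : G) (v : V) :
    MulAction.stabilizer G (g • v) = conj g (MulAction.stabilizer G v) := by
  ext y
  rw [mem_conj, MulAction.mem_stabilizer_iff, MulAction.mem_stabilizer_iff, mul_smul, mul_smul,
    inv_smul_eq_iff]

variable [TopologicalSpace G]

theorem exists_isContraction_of_mulAction {V : Type*} [MulAction G V] [Nonempty V]
    [MulAction.IsPretransitive G V] [FaithfulSMul G V] {p : V → V}
    (hc : ∀ v w, ∃ m n, p^[m] v = p^[n] w) (hsmul : ∀ (g : G) v, p (g • v) = g • p v)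
    (ho : ∀ v : V, IsOpen (MulAction.stabilizer G v : Set G))
    (hk : ∀ v : V, IsCompact (MulAction.stabilizer G v : Set G)) {q : ℕ} (hq : 2 ≤ q)
    (hfib : ∀ v, (p ⁻¹' {v}).encard = q) :
    ∃ (U : Subgroup G) (t : G), IsContraction U t ∧ (conj t U).relIndex U = q := by
  obtain ⟨v₀⟩ := ‹Nonempty V›
  -- Then `t • v₀` is a child of `v₀`. Its stabiliser fixes the parent `v₀`, and anything moving it
  -- to another child of `v₀` fixes `v₀` as well, so the index counts children.
  obtain ⟨t, ht⟩ := MulAction.exists_smul_eq G (p v₀) v₀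
  have hpt : p (t • v₀) = v₀ := by rw [hsmul, ht]
  have hidx : (conj t (MulAction.stabilizer G v₀)).relIndex (MulAction.stabilizer G v₀) = q := by
    rw [← stabilizer_smul_eq_conj, relIndex_stabilizer]
    have : {c | ∃ g : G, g • v₀ = v₀ ∧ g • t • v₀ = c} = p ⁻¹' {v₀} := by
      ext c
      constructor
      · rintro ⟨g, hg, rfl⟩
        rw [Set.mem_preimage, Set.mem_singleton_iff, hsmul, hpt, hg]
      · intro hcv
        obtain ⟨g, rfl⟩ := MulAction.exists_smul_eq G (t • v₀) c
        refine ⟨g, ?_, rfl⟩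
        rwa [Set.mem_preimage, Set.mem_singleton_iff, hsmul, hpt] at hcv
    rw [this, Set.ncard_def, hfib]
    rfl
  have hiter : ∀ n : ℕ, p^[n] v₀ = (t ^ n)⁻¹ • v₀ := by
    intro n
    induction n with
    | zero => simp
    | succ n ih =>
      rw [Function.iterate_succ_apply', ih, hsmul, pow_succ', mul_inv_rev, mul_smul]
      congr 1
      rw [eq_inv_smul_iff, ht]
  have hitersmul : ∀ (g : G) n, p^[n] (g • v₀) = g • p^[n] v₀ := fun g n =>
    ((Function.Semiconj.iterate_right (f := fun w : V => g • w) (fun w => (hsmul g w).symm) n)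
      v₀).symm
  refine ⟨MulAction.stabilizer G v₀, t, ⟨ho v₀, hk v₀, ?_, by rwa [hidx], fun g => ?_,
    fun u hu => ?_⟩, hidx⟩
  · rw [← stabilizer_smul_eq_conj]
    intro g hg
    rw [MulAction.mem_stabilizer_iff] at hg ⊢
    have := hsmul g (t • v₀)
    rwa [hg, hpt, eq_comm] at this
  · obtain ⟨m, n, h⟩ := hc (g • v₀) v₀
    refine ⟨m, n, ?_⟩
    rw [hitersmul, hiter, hiter] at h
    rw [MulAction.mem_stabilizer_iff, mul_smul, mul_smul, h, smul_inv_smul]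
  · refine eq_of_smul_eq_smul (α := V) fun v => ?_
    obtain ⟨g, rfl⟩ := MulAction.exists_smul_eq G v₀ v
    have := hu g⁻¹
    rw [inv_inv, MulAction.mem_stabilizer_iff, mul_smul, mul_smul, inv_smul_eq_iff] at this
    rw [this, one_smul]

theorem HasFaithfulScaleRep.exists_isContraction {q : ℕ} (hq : 2 ≤ q)
    (h : HasFaithfulScaleRep G q) :
    ∃ (U : Subgroup G) (t : G), IsContraction U t ∧ (conj t U).relIndex U = q := by
  obtain ⟨V, T, ω, P, hT, hP, ⟨e⟩⟩ := h
  let φ : G →* (T ≃g T) := P.subtype.comp e.toMulEquiv.toMonoidHom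
  have hφ : Topology.IsClosedEmbedding φ :=
    hP.isClosed.isClosedEmbedding_subtypeVal.comp e.toHomeomorph.isClosedEmbedding
  have hφP : ∀ g, φ g ∈ P := fun g => (e g).2
  have hrange : ∀ f ∈ P, ∃ g, φ g = f := fun f hf =>
    ⟨e.symm ⟨f, hf⟩, congrArg Subtype.val (e.apply_symm_apply ⟨f, hf⟩)⟩
  let _ : MulAction G V := MulAction.compHom V φ
  have hact : ∀ (g : G) (v : V), g • v = φ g v := fun _ _ => rfl
  have : Nonempty V := hT.isTree.connected.nonempty
  have : MulAction.IsPretransitive G V := ⟨fun v w => by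
    obtain ⟨f, hf, hfv⟩ := hP.transitive v w
    obtain ⟨g, rfl⟩ := hrange f hf
    exact ⟨g, hfv⟩⟩
  have : FaithfulSMul G V := ⟨fun {g g'} hg => hφ.injective (by ext v; exact hg v)⟩
  -- Transitivity carries one ray of the fixed end to every starting vertex.
  have hω : ∀ v, ∃ r : Ray T, r.toFun 0 = v ∧ Quotient.mk _ r = ω := by
    intro v
    obtain ⟨r, rfl⟩ := Quotient.exists_rep ω
    obtain ⟨f, hf, hfv⟩ := hP.transitive (r.toFun 0) v
    exact ⟨Ray.map f r, hfv, hP.fixes f hf⟩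
  obtain ⟨p, hp, hc, hTp, hpf⟩ := exists_parent hT.isTree.isAcyclic ω hω
  have hfin : ∀ v, (T.neighborSet v).Finite := fun v =>
    Set.finite_of_encard_eq_coe (hT.valency v)
  have ho : ∀ v : V, IsOpen (MulAction.stabilizer G v : Set G) := fun v =>
    (isOpen_setOf_apply_eq v v).preimage hφ.continuous
  have hk : ∀ v : V, IsCompact (MulAction.stabilizer G v : Set G) := fun v =>
    hφ.isCompact_preimage (isCompact_setOf_apply_eq_self hfin hT.isTree.connected v)
  refine exists_isContraction_of_mulAction hc (fun g v => hpf _ (hP.fixes _ (hφP g)) v) ho hk hq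
    fun v => ?_
  have h1 := hT.valency v
  rw [hTp, encard_neighborSet_parentGraph hp] at h1
  push_cast at h1
  exact (ENat.add_left_injective_of_ne_top ENat.one_ne_top) h1

end Action

end ScaleGroup

theorem corollary4p2 {G : Type u} [Group G] [TopologicalSpace G] [IsTopologicalGroup G]
    [LocallyCompactSpace G] :
    ((∃ q : ℕ, 2 ≤ q ∧ ScaleGroup.HasFaithfulScaleRep G q) ↔
      (∀ N : Subgroup G, N.Normal → IsCompact (N : Set G) → N = ⊥) ∧
      ∃ (H : Subgroup G) (_ : H.Normal), IsOpen (H : Set G) ∧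
        Nonempty (G ⧸ H ≃* Multiplicative ℤ) ∧
        ∃ (V : Subgroup G) (x : G), IsOpen (V : Set G) ∧ IsCompact (V : Set G) ∧
          ScaleGroup.conj x V < V ∧
          (⋃ n : ℤ, (ScaleGroup.conj (x ^ n) V : Set G)) = (H : Set G)) ∧
    ((∃ q : ℕ, 2 ≤ q ∧ ScaleGroup.HasFaithfulScaleRep G q) →
      ∃ q : ℕ, IsLeast {n : ℕ | (∃ y : G, ScaleGroup.scale y = n) ∧ n ≠ 1} q ∧ 2 ≤ q ∧
        ScaleGroup.HasFaithfulScaleRep G q) := by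
  refine ⟨⟨?_, ?_⟩, ?_⟩
  · rintro ⟨q, hq, h⟩
    obtain ⟨U, t, hU, -⟩ := h.exists_isContraction hq
    exact ScaleGroup.eq_bot_and_exists_of_isContraction hU
  · rintro ⟨hN, H, _, -, ⟨e⟩, V, x, hV, hV', hlt, hU⟩
    obtain ⟨U, t, h⟩ := ScaleGroup.exists_isContraction hN e hV hV' hlt hU
    exact ⟨_, h.two_le, h.hasFaithfulScaleRep⟩
  · rintro ⟨q, hq, h⟩
    -- The given `q` is itself the index of the contraction, so it is already the least non-trivial
    -- scale.
    obtain ⟨U, t, hU, rfl⟩ := h.exists_isContraction hq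
    exact ⟨_, hU.isLeast_scale, hq, h⟩
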